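/- Let $0<\alpha<2$, $\nu>0$, $\sigma>0$, let $d,n\ge 0$ be integers and let $\mathbf{x}_1,\dots,\mathbf{x}_n\in\mathbb{R}^d$. Write $\mathrm{sign}(z)=1,-1,0$ for $z>0$, $z<0$, $z=0$. For $m\ge 1$ consider the one-hidden-layer network of width $m$, $$f_m(\mathbf{z})=\sum_{j=1}^m w_j\,\mathrm{sign}\Big(b_j+\sum_{i=1}^d w_{ij}z_i\Big),\qquad \mathbf{z}\in\mathbb{R}^d,$$ where all weights are independent, the $b_j$ and $w_{ij}$ are standard Gaussian, and each $w_j$ is symmetric $\alpha$-stable with scale $c_m=(\nu/2)^{1/2}m^{-1/\alpha}$, i.e. $\mathbb{E}e^{itw_j}=\exp(-c_m^\alpha|t|^\alpha)$. Let $f$ be a process on $\mathbb{R}^d$ that is the infinite-width limit of these networks: all finite-dimensional distributions of $f_m$ converge to those of $f$ as $m\to\infty$. Observe $y_i=f(\mathbf{x}_i)+\varepsilon_i$, $i=1,\dots,n$, where the $\varepsilon_i$ are i.i.d. $\mathcal{N}(0,\sigma^2)$ and independent of $(f(\mathbf{x}_1),\dots,f(\mathbf{x}_n))$. For $\tau\in\{-1,+1\}^n$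 let $q_\tau=\mathbb{P}\big(\mathrm{sign}(b_0+\sum_i w_ix_{ji})=\tau_j \text{ for } j=1,\dots,n\big)$ with $b_0,w_1,\dots,w_d$ i.i.d. standard Gaussian. Let $\tau_1,\dots,\tau_L$ be the distinct sign patterns with $q_\ell:=q_{\tau_\ell}>0$. Let $p_{S^+}$ be a density, vanishing on $(-\infty,0]$, of the positive $\alpha/2$-stable law, normalised so that its characteristic function is $$\exp\Big(-\cos\big(\tfrac{\pi\alpha}{4}\big)|t|^{\alpha/2}\big(1-i\,\mathrm{sign}(t)\tan\tfrac{\pi\alpha}{4}\big)\Big)$$ (equivalently, its Laplace transform is $\lambda\mapsto\exp(-\lambda^{\alpha/2})$). For $s=(s_1,\dots,s_L)$ put $$\mathbf{Q}=\mathbf{Q}(s)=\sigma^2\mathbf{I}+\nu\sum_{\ell=1}^L q_\ell^{2/\alpha}s_\ell\,\tau_\ell\tau_\ell^T .$$ Thus $\mathbf{Q}$ has diagonal entries $\sigma^2+\nu\sum_\ell q_\ell^{2/\alpha}s_\ell$ and off-diagonal entries $\nu\sum_\ell q_\ell^{2/\alpha}s_\ell\,\tau_{\ell,i}\tau_{\ell,j}$.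 Then $\mathbf{Q}$ is positive definite with probability one when the $s_\ell$ are i.i.d. with density $p_{S^+}$, and $\mathbf{y}=(y_1,\dots,y_n)$ has the joint probability density $$p(\mathbf{y})=(2\pi)^{-n/2}\int_{(0,\infty)^L}\exp\Big(-\tfrac12\mathbf{y}^T\mathbf{Q}^{-1}\mathbf{y}\Big)\det(\mathbf{Q})^{-1/2}\prod_{\ell=1}^L p_{S^+}(s_\ell)\,ds_\ell ,$$ where the integral converges absolutely for every $\mathbf{y}\in\mathbb{R}^n$. -/

import Mathlib

open MeasureTheory ProbabilityTheory Filter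

noncomputable section

namespace StableNet

/-- The function `ω(t; α)` in the characteristic function of a stable law:
`tan (α π / 2)` if `α ≠ 1`, and `-(2 / π) log |t|` if `α = 1`. -/
def stableOmega (α t : ℝ) : ℝ :=
  if α = 1 then -(2 / Real.pi) * Real.log |t| else Real.tan (α * Real.pi / 2)

/-- The characteristic function of the stable law `S(α, β, ν)` with zero shift, index `α`,
symmetry parameter `β` and scale `ν`:
`t ↦ exp (-ν^α |t|^α (1 - i β sign(t) ω(t; α)))`. -/
def stableCharFun (α β ν t : ℝ) : ℂ :=
  Complex.exp (-((ν ^ α * |t| ^ α : ℝ) : ℂ) *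
    (1 - Complex.I * ((β * Real.sign t * stableOmega α t : ℝ) : ℂ)))

/-- `μ` is the stable law `S(α, β, ν)` on the real line. -/
def IsStableLaw (α β ν : ℝ) (μ : Measure ℝ) : Prop :=
  IsProbabilityMeasure μ ∧ ∀ t : ℝ, charFun μ t = stableCharFun α β ν t

/-- The measure on `ℝ` with Lebesgue density `p`. -/
def densityLaw (p : ℝ → ℝ) : Measure ℝ :=
  volume.withDensity (fun t => ENNReal.ofReal (p t))

/-- `p` is the density of the standard positive `a`-stable law, `0 < a < 1`: a probability density
carried by `(0, ∞)` whose law is the totally skewed stable law `S(a, 1, cos(π a / 2)^(1/a))`.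
The scale is the one for which the characteristic function is `exp (-(-i t)^a)`, that is, the
standard one for positive stable variables. -/
structure IsPositiveStableDensity (a : ℝ) (p : ℝ → ℝ) : Prop where
  measurable : Measurable p
  nonneg : ∀ t, 0 ≤ p t
  eq_zero_of_nonpos : ∀ t, t ≤ 0 → p t = 0
  isStableLaw : IsStableLaw a 1 (Real.cos (Real.pi * a / 2) ^ (1 / a)) (densityLaw p)

/-- The law of the inner parameters `(b₀, (w₁, …, w_d))` of one hidden unit: i.i.d. standard
Gaussian variables. -/
def innerLaw (d : ℕ) : Measure (ℝ × (Fin d → ℝ)) :=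
  (gaussianReal 0 1).prod (Measure.pi fun _ => gaussianReal 0 1)

instance (d : ℕ) : IsProbabilityMeasure (innerLaw d) := by
  unfold innerLaw; infer_instance

/-- The output `sign (b₀ + ∑ᵢ wᵢ zᵢ)` of a hidden unit with parameters `(b₀, w)` at input `z`. -/
def hiddenUnit {d : ℕ} (u : ℝ × (Fin d → ℝ)) (z : Fin d → ℝ) : ℝ :=
  Real.sign (u.1 + ∑ i, u.2 i * z i)

/-- The prior law of all parameters of a one-hidden-layer network with `m` hidden units: the
parameters of different units are i.i.d., and in each unit the output weight (with law `W`) is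
independent of the inner parameters. -/
def networkPrior (d m : ℕ) (W : ProbabilityMeasure ℝ) :
    Measure (Fin m → ℝ × (ℝ × (Fin d → ℝ))) :=
  Measure.pi fun _ => (W : Measure ℝ).prod (innerLaw d)

instance (d m : ℕ) (W : ProbabilityMeasure ℝ) : IsProbabilityMeasure (networkPrior d m W) := by
  unfold networkPrior; infer_instance

/-- The output `∑ⱼ wⱼ sign (bⱼ + ∑ᵢ wᵢⱼ zᵢ)` at input `z` of the network with parameters `θ`. -/
def networkOutput {d m : ℕ} (θ : Fin m → ℝ × (ℝ × (Fin d → ℝ))) (z : Fin d → ℝ) : ℝ :=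
  ∑ j, (θ j).1 * hiddenUnit (θ j).2 z

/-- The process `f` is the infinite-width limit of the networks whose output weights, at width `m`,
are i.i.d. symmetric `α`-stable with scale `(ν/2)^(1/2) m^(-1/α)`: all finite-dimensional
distributions of the network output converge to those of `f` as the width tends to infinity. -/
def IsInfiniteWidthLimit {d : ℕ} {Ω : Type*} [MeasurableSpace Ω] (P : Measure Ω)
    [IsProbabilityMeasure P] (α ν : ℝ) (f : (Fin d → ℝ) → Ω → ℝ) : Prop :=
  ∃ W : ℕ → ProbabilityMeasure ℝ,
    (∀ m : ℕ, 0 < m →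
      IsStableLaw α 0 ((ν / 2) ^ (1 / 2 : ℝ) * (m : ℝ) ^ (-1 / α)) (W m : Measure ℝ)) ∧
    ∀ (k : ℕ) (z : Fin k → Fin d → ℝ),
      TendstoInDistribution
        (fun (m : ℕ) (θ : Fin m → ℝ × (ℝ × (Fin d → ℝ))) (i : Fin k) => networkOutput θ (z i))
        atTop (fun ω i => f (z i) ω) (fun m => networkPrior d m (W m)) P

/-- The real vector `(τ(x₁), …, τ(xₙ))` of a sign pattern. -/
def signVec {n : ℕ} (τ : Fin n → ℤˣ) : Fin n → ℝ := fun j => (((τ j : ℤˣ) : ℤ) : ℝ)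

/-- The probability `q_τ` that the random hyperplane unit produces the sign pattern `τ` on the
inputs `x₁, …, xₙ`. -/
def patternProb {n d : ℕ} (x : Fin n → Fin d → ℝ) (τ : Fin n → ℤˣ) : ℝ :=
  (innerLaw d).real {u | ∀ j, hiddenUnit u (x j) = signVec τ j}

/-- The sign patterns of positive probability; their number is `L`. -/
abbrev PosPattern {n d : ℕ} (x : Fin n → Fin d → ℝ) : Type :=
  {τ : Fin n → ℤˣ // 0 < patternProb x τ}

instance {n d : ℕ} (x : Fin n → Fin d → ℝ) : Fintype (PosPattern x) := Fintype.ofFinite _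

/-- The matrix `Q = σ² I + ν ∑_ℓ q_ℓ^(2/α) s_ℓ τ_ℓ τ_ℓᵀ`. -/
def covQ {n d : ℕ} (α ν σ : ℝ) (x : Fin n → Fin d → ℝ) (s : PosPattern x → ℝ) :
    Matrix (Fin n) (Fin n) ℝ :=
  σ ^ 2 • (1 : Matrix (Fin n) (Fin n) ℝ) +
    ν • ∑ l : PosPattern x, (patternProb x l.1 ^ (2 / α) * s l) •
      Matrix.vecMulVec (signVec l.1) (signVec l.1)

/-- The integrand `exp (-yᵀ Q⁻¹ y / 2) det(Q)^(-1/2) ∏_ℓ p(s_ℓ)`. -/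
def mixtureIntegrand {n d : ℕ} (α ν σ : ℝ) (x : Fin n → Fin d → ℝ) (p : ℝ → ℝ)
    (y : Fin n → ℝ) (s : PosPattern x → ℝ) : ℝ :=
  Real.exp (-(1 / 2) * (y ⬝ᵥ (Matrix.mulVec (covQ α ν σ x s)⁻¹ y))) *
    (covQ α ν σ x s).det ^ (-(1 / 2) : ℝ) * ∏ l, p (s l)

/-- The Gaussian scale mixture
`(2π)^(-n/2) ∫_{(0,∞)^L} exp (-yᵀ Q⁻¹ y / 2) det(Q)^(-1/2) ∏_ℓ p(s_ℓ) ds_ℓ`. -/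
def mixtureDensity {n d : ℕ} (α ν σ : ℝ) (x : Fin n → Fin d → ℝ) (p : ℝ → ℝ)
    (y : Fin n → ℝ) : ℝ :=
  (2 * Real.pi) ^ (-(n : ℝ) / 2) *
    ∫ s in Set.univ.pi (fun _ : PosPattern x => Set.Ioi (0 : ℝ)), mixtureIntegrand α ν σ x p y s

end StableNet

end

/-!
Both sides are identified through their characteristic functions.

A network of width `m` is a sum of `m` i.i.d. terms, and the sign vector of one hidden unit is almost
surely one of the patterns `τ_ℓ`, with probability `q_ℓ` (`integral_comp_hiddenUnit`; the Gaussian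
bias excludes the sign `0`). Hence the characteristic function of its outputs at `t` is
`(∑ q_ℓ exp (-(ν/2)^(α/2) |t ⬝ τ_ℓ|^α / m)) ^ m`, which tends to
`exp (-(ν/2)^(α/2) ∑ q_ℓ |t ⬝ τ_ℓ|^α)` (`IsInfiniteWidthLimit.integral_exp`). The errors contribute
the factor `exp (-σ² |t|² / 2)`.

For the mixture, given `s` the law is centred Gaussian with covariance `Q(s)`, so that the
characteristic function is the mean of
`exp (-t ⬝ Q(s) t / 2) = exp (-σ² |t|² / 2) ∏ exp (-(ν/2) q_ℓ^(2/α) (t ⬝ τ_ℓ)² s_ℓ)`. By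
independence this is a product of Laplace transforms `r ↦ exp (-r^(α/2))` of the positive stable law,
and gives the same function (`integral_exp_mul_mixtureDensity`, `half_mul_rpow_eq`).

The stable law is given by its characteristic function. The Laplace transform is deduced from it by
the Phragmén–Lindelöf principle in the right half-plane
(`integral_exp_neg_mul_eq_of_imaginary_axis`). The absolute convergence of the mixture integral for
every `y` comes from `det Q ≥ σ^(2n)` (`pow_le_det_smul_one_add`).
-/

namespace StableNet

/-! ### The Laplace transform of the positive stable law -/

lemma re_cpow_nonneg {a : ℝ} (ha : 0 < a) (ha1 : a < 1) {z : ℂ} (hz : 0 ≤ z.re) :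
    0 ≤ (z ^ (a : ℂ)).re := by
  rcases eq_or_ne z 0 with rfl | h0
  · simp [Complex.zero_cpow, ha.ne']
  rw [Complex.cpow_def_of_ne_zero h0, Complex.exp_re]
  have him : (Complex.log z * (a : ℂ)).im = z.arg * a := by
    simp [Complex.mul_im, Complex.log_im]
  have harg : |z.arg| ≤ Real.pi / 2 := Complex.abs_arg_le_pi_div_two_iff.2 hz
  rw [him]
  refine mul_nonneg (Real.exp_pos _).le (Real.cos_nonneg_of_neg_pi_div_two_le_of_le ?_ ?_)
  · rw [abs_le] at harg
    nlinarith [Real.pi_pos]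
  · rw [abs_le] at harg
    nlinarith [Real.pi_pos]

lemma norm_exp_neg_cpow_le_one {a : ℝ} (ha : 0 < a) (ha1 : a < 1) {z : ℂ} (hz : 0 ≤ z.re) :
    ‖Complex.exp (-z ^ (a : ℂ))‖ ≤ 1 := by
  rw [Complex.norm_exp, Complex.neg_re]
  exact Real.exp_le_one_iff.2 (by linarith [re_cpow_nonneg ha ha1 hz])

lemma diffContOnCl_exp_neg_cpow {a : ℝ} (ha : 0 < a) :
    DiffContOnCl ℂ (fun z : ℂ => Complex.exp (-z ^ (a : ℂ))) {z | 0 < z.re} := by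
  constructor
  · intro z hz
    have hz' : z ∈ Complex.slitPlane := Or.inl hz
    exact ((((differentiableAt_id).cpow_const hz').neg).cexp).differentiableWithinAt
  · rw [Complex.closure_setOfPred_lt_re]
    intro z hz
    refine ContinuousAt.continuousWithinAt ?_
    refine Complex.continuous_exp.continuousAt.comp (ContinuousAt.neg ?_)
    exact Complex.continuousAt_cpow_const_of_re_pos (Or.inl hz) (by simpa using ha)

section Laplace

variable {μ : Measure ℝ} [IsProbabilityMeasure μ]

lemma norm_integral_exp_neg_mul_le (hμ : ∀ᵐ s ∂μ, 0 ≤ s) {z : ℂ} (hz : 0 ≤ z.re) :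
    ‖∫ s, Complex.exp (-z * s) ∂μ‖ ≤ 1 := by
  have h := norm_integral_le_of_norm_le_const (μ := μ) (f := fun s : ℝ => Complex.exp (-z * s))
    (C := 1) (by
      filter_upwards [hμ] with s hs
      rw [Complex.norm_exp]
      simpa using mul_nonneg hz hs)
  simpa using h

lemma diffContOnCl_integral_exp_neg_mul (hμ : ∀ᵐ s ∂μ, 0 ≤ s) :
    DiffContOnCl ℂ (fun z : ℂ => ∫ s, Complex.exp (-z * s) ∂μ) {z | 0 < z.re} := by
  constructor
  · intro z hz
    have hint : (-z).re ∈ interior (integrableExpSet id μ) := by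
      refine mem_interior.2 ⟨Set.Iio 0, fun r hr => ?_, isOpen_Iio, by simpa using hz⟩
      refine Integrable.of_bound (by fun_prop) 1 ?_
      filter_upwards [hμ] with s hs
      simpa using mul_nonpos_of_nonpos_of_nonneg (le_of_lt hr) hs
    have h1 := (hasDerivAt_complexMGF hint).differentiableAt
    have h2 : DifferentiableAt ℂ (fun w => complexMGF id μ (-w)) z :=
      DifferentiableAt.comp (f := fun w : ℂ => -w) z h1 differentiableAt_id.neg
    exact h2.differentiableWithinAt
  · rw [Complex.closure_setOfPred_lt_re]
    intro z hz
    refine continuousWithinAt_of_dominated (bound := fun _ => 1) ?_ ?_ (integrable_const _) ?_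
    · exact Eventually.of_forall fun w => by fun_prop
    · filter_upwards [self_mem_nhdsWithin] with w hw
      filter_upwards [hμ] with s hs
      rw [Complex.norm_exp]
      simpa using mul_nonneg hw hs
    · exact Eventually.of_forall fun s => by fun_prop

/-- A probability measure on `[0, ∞)` whose Fourier transform is the boundary value
of `exp (-z ^ a)` on the imaginary axis has Laplace transform `exp (-r ^ a)`. Both sides extend to
bounded functions on the closed right half-plane, holomorphic inside, so they agree by the
Phragmén–Lindelöf principle. -/
lemma integral_exp_neg_mul_eq_of_imaginary_axis {a : ℝ} (ha : 0 < a) (ha1 : a < 1)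
    (hμ : ∀ᵐ s ∂μ, 0 ≤ s)
    (him : ∀ y : ℝ, ∫ s, Complex.exp (-(y * Complex.I) * s) ∂μ =
      Complex.exp (-(y * Complex.I) ^ (a : ℂ))) {r : ℝ} (hr : 0 ≤ r) :
    ∫ s, Real.exp (-r * s) ∂μ = Real.exp (-r ^ a) := by
  have hbd : ∀ z : ℂ, 0 ≤ z.re →
      ‖(∫ s, Complex.exp (-z * s) ∂μ) - Complex.exp (-z ^ (a : ℂ))‖ ≤ 2 := fun z hz =>
    (norm_sub_le _ _).trans (by
      linarith [norm_integral_exp_neg_mul_le hμ hz, norm_exp_neg_cpow_le_one ha ha1 hz])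
  -- The difference of the two sides vanishes on the imaginary axis, hence the bound `C = 0`.
  have key := PhragmenLindelof.right_half_plane_of_bounded_on_real (C := 0) (z := (r : ℂ))
    ((diffContOnCl_integral_exp_neg_mul hμ).sub (diffContOnCl_exp_neg_cpow ha))
    ⟨0, by norm_num, 0, by
      refine Asymptotics.IsBigO.of_bound 2 ?_
      filter_upwards [mem_inf_of_right (mem_principal_self _)] with z hz
      simpa using hbd z (le_of_lt hz)⟩
    (isBoundedUnder_of_eventually_le (a := 2) (by
      filter_upwards [eventually_ge_atTop 0] with y hy
      exact hbd y (by simpa using hy)))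
    (fun y => by
      rw [Pi.sub_apply, him y, sub_self, norm_zero]) (by simpa using hr)
  have h0 := sub_eq_zero.1 (norm_le_zero_iff.1 key)
  have h1 : (∫ s, Complex.exp (-(r : ℂ) * s) ∂μ) = ((∫ s, Real.exp (-r * s) ∂μ : ℝ) : ℂ) := by
    rw [← integral_complex_ofReal]
    simp
  beta_reduce at h0
  rw [h1, ← Complex.ofReal_cpow hr, ← Complex.ofReal_neg, ← Complex.ofReal_exp] at h0
  exact_mod_cast h0

end Laplace

lemma ofReal_mul_cpow {r : ℝ} (hr : 0 < r) {z : ℂ} (hz : z ≠ 0) (w : ℂ) :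
    ((r : ℂ) * z) ^ w = (r : ℂ) ^ w * z ^ w := by
  have hr' : (r : ℂ) ≠ 0 := mod_cast hr.ne'
  rw [Complex.cpow_def_of_ne_zero (mul_ne_zero hr' hz), Complex.cpow_def_of_ne_zero hr',
    Complex.cpow_def_of_ne_zero hz, Complex.log_ofReal_mul hr hz, add_mul, Complex.exp_add,
    Complex.ofReal_log hr.le]

/-- The characteristic function of the positive stable law is the boundary value of
`exp (-z ^ a)` on the imaginary axis. -/
lemma stableCharFun_neg_eq {a : ℝ} (ha : 0 < a) (ha1 : a < 1) (y : ℝ) :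
    stableCharFun a 1 (Real.cos (Real.pi * a / 2) ^ (1 / a)) (-y) =
      Complex.exp (-(y * Complex.I) ^ (a : ℂ)) := by
  have hc : 0 < Real.cos (Real.pi * a / 2) :=
    Real.cos_pos_of_mem_Ioo ⟨by nlinarith [Real.pi_pos], by nlinarith [Real.pi_pos]⟩
  have hcc : (Real.cos (Real.pi * a / 2) ^ (1 / a)) ^ a = Real.cos (Real.pi * a / 2) := by
    rw [← Real.rpow_mul hc.le, one_div_mul_cancel ha.ne', Real.rpow_one]
  unfold stableCharFun stableOmega
  rw [if_neg ha1.ne, hcc]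
  congr 1
  rw [show a * Real.pi / 2 = Real.pi * a / 2 by ring]
  have hcos : Real.tan (Real.pi * a / 2) * Real.cos (Real.pi * a / 2)
      = Real.sin (Real.pi * a / 2) := Real.tan_mul_cos hc.ne'
  have hlog : Complex.log Complex.I * a = ((Real.pi * a / 2 : ℝ) : ℂ) * Complex.I := by
    rw [Complex.log_I]; push_cast; ring
  have hlog' : Complex.log (-Complex.I) * a = ((-(Real.pi * a / 2) : ℝ) : ℂ) * Complex.I := by
    rw [Complex.log_neg_I]; push_cast; ring
  have hcos' : (Real.tan (Real.pi * a / 2) : ℂ) * Real.cos (Real.pi * a / 2)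
      = Real.sin (Real.pi * a / 2) := mod_cast hcos
  rcases lt_trichotomy y 0 with hy | rfl | hy
  · rw [Real.sign_of_pos (by linarith : 0 < -y), abs_neg, abs_of_neg hy]
    have : (y : ℂ) * Complex.I = ((-y : ℝ) : ℂ) * (-Complex.I) := by push_cast; ring
    rw [this, ofReal_mul_cpow (by linarith) (by simp), ← Complex.ofReal_cpow (by linarith),
      Complex.cpow_def_of_ne_zero (by simp : -Complex.I ≠ 0), hlog', Complex.exp_mul_I,
      ← Complex.ofReal_cos, ← Complex.ofReal_sin, Real.cos_neg, Real.sin_neg]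
    push_cast at hcos' ⊢
    linear_combination Complex.I * (((-y) ^ a : ℝ) : ℂ) * hcos'
  · simp [ha.ne']
  · rw [Real.sign_of_neg (by linarith : -y < 0), abs_neg, abs_of_pos hy]
    rw [ofReal_mul_cpow hy Complex.I_ne_zero, ← Complex.ofReal_cpow hy.le,
      Complex.cpow_def_of_ne_zero Complex.I_ne_zero, hlog, Complex.exp_mul_I,
      ← Complex.ofReal_cos, ← Complex.ofReal_sin]
    push_cast at hcos' ⊢
    linear_combination -Complex.I * ((y ^ a : ℝ) : ℂ) * hcos'

namespace IsPositiveStableDensity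

variable {a : ℝ} {p : ℝ → ℝ}

lemma isProbabilityMeasure (hp : IsPositiveStableDensity a p) :
    IsProbabilityMeasure (densityLaw p) := hp.isStableLaw.1

lemma ae_pos (hp : IsPositiveStableDensity a p) : ∀ᵐ s ∂densityLaw p, 0 < s := by
  rw [densityLaw, ae_withDensity_iff (by exact hp.measurable.ennreal_ofReal)]
  refine Eventually.of_forall fun s hs => ?_
  by_contra h
  exact hs (by simp [hp.eq_zero_of_nonpos s (not_lt.1 h)])

lemma integrable (hp : IsPositiveStableDensity a p) : Integrable p := by
  have := hp.isProbabilityMeasure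
  refine ⟨hp.measurable.aestronglyMeasurable, ?_⟩
  rw [hasFiniteIntegral_iff_ofReal (Eventually.of_forall hp.nonneg)]
  have h : densityLaw p Set.univ = 1 := measure_univ
  rw [densityLaw, withDensity_apply _ MeasurableSet.univ, Measure.restrict_univ] at h
  simp [h]

lemma integral_exp_neg_mul (hp : IsPositiveStableDensity a p) (ha : 0 < a) (ha1 : a < 1)
    {r : ℝ} (hr : 0 ≤ r) : ∫ s, Real.exp (-r * s) ∂densityLaw p = Real.exp (-r ^ a) := by
  have := hp.isProbabilityMeasure
  refine integral_exp_neg_mul_eq_of_imaginary_axis ha ha1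
    (hp.ae_pos.mono fun s hs => hs.le) (fun y => ?_) hr
  rw [← stableCharFun_neg_eq ha ha1, ← hp.isStableLaw.2, charFun_apply_real]
  refine integral_congr_ae (Eventually.of_forall fun s => ?_)
  simp only
  congr 1
  push_cast
  ring

end IsPositiveStableDensity

/-! ### Centred Gaussian densities on `ℝⁿ` -/

section Gaussian

variable {n : ℕ}

/-- The Lebesgue density of the centred Gaussian law on `ℝⁿ` with covariance matrix `Q`,
for `Q` positive definite. -/
noncomputable def gaussianDensity (Q : Matrix (Fin n) (Fin n) ℝ) (y : Fin n → ℝ) : ℝ :=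
  (2 * Real.pi) ^ (-(n : ℝ) / 2) *
    (Real.exp (-(1 / 2) * (y ⬝ᵥ Matrix.mulVec Q⁻¹ y)) * Q.det ^ (-(1 / 2) : ℝ))

open scoped MatrixOrder in
lemma exists_transpose_mul_self {Q : Matrix (Fin n) (Fin n) ℝ} (hQ : Q.PosDef) :
    ∃ B : Matrix (Fin n) (Fin n) ℝ, Q = B.transpose * B ∧ B.det ≠ 0 := by
  obtain ⟨B, hB⟩ := CStarAlgebra.nonneg_iff_eq_star_mul_self.mp hQ.posSemidef.nonneg
  have hB' : Q = B.transpose * B := by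
    rw [hB, Matrix.star_eq_conjTranspose, Matrix.conjTranspose_eq_transpose_of_trivial]
  refine ⟨B, hB', fun h => hQ.det_pos.ne' ?_⟩
  rw [hB', Matrix.det_mul, h, mul_zero]

lemma dotProduct_inv_mulVec_transpose {B : Matrix (Fin n) (Fin n) ℝ} (hB : B.det ≠ 0)
    (v : Fin n → ℝ) :
    (B.transpose.mulVec v) ⬝ᵥ (B.transpose * B)⁻¹.mulVec (B.transpose.mulVec v) = v ⬝ᵥ v := by
  have hB1 : IsUnit B.det := isUnit_iff_ne_zero.2 hB
  have hB2 : IsUnit B.transpose.det := by rwa [Matrix.det_transpose]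
  rw [Matrix.mul_inv_rev, Matrix.mulVec_mulVec, Matrix.mul_assoc, Matrix.nonsing_inv_mul _ hB2,
    Matrix.mul_one, Matrix.dotProduct_mulVec, Matrix.mulVec_transpose,
    Matrix.vecMul_vecMul, Matrix.mul_nonsing_inv _ hB1, Matrix.vecMul_one]

lemma measurableEmbedding_mulVec {M : Matrix (Fin n) (Fin n) ℝ} (hM : M.det ≠ 0) :
    MeasurableEmbedding M.mulVec := by
  have hc : Continuous M.mulVec := by fun_prop
  refine hc.measurableEmbedding (Matrix.mulVec_injective_of_isUnit ?_)
  rw [Matrix.isUnit_iff_isUnit_det]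
  exact isUnit_iff_ne_zero.2 hM

lemma volume_eq_smul_map_mulVec {M : Matrix (Fin n) (Fin n) ℝ} (hM : M.det ≠ 0) :
    (volume : Measure (Fin n → ℝ)) =
      ENNReal.ofReal |M.det| • Measure.map M.mulVec (volume : Measure (Fin n → ℝ)) := by
  have h := Real.map_matrix_volume_pi_eq_smul_volume_pi hM
  have h' : Measure.map M.mulVec (volume : Measure (Fin n → ℝ)) =
    ENNReal.ofReal |M.det⁻¹| • volume := h
  rw [h', smul_smul, ← ENNReal.ofReal_mul (abs_nonneg _), ← abs_mul, mul_inv_cancel₀ hM]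
  simp

/-- The Gaussian integral, by the substitution `y = Bᵀ v` with `Q = Bᵀ B`. -/
lemma integrable_and_integral_gaussianDensity {Q : Matrix (Fin n) (Fin n) ℝ} (hQ : Q.PosDef)
    (t : Fin n → ℝ) :
    Integrable (fun y => Complex.exp (((t ⬝ᵥ y : ℝ) : ℂ) * Complex.I) *
      (gaussianDensity Q y : ℂ)) ∧
    ∫ y, Complex.exp (((t ⬝ᵥ y : ℝ) : ℂ) * Complex.I) * (gaussianDensity Q y : ℂ) =
      Complex.exp (((-(1 / 2) * (t ⬝ᵥ Q.mulVec t) : ℝ) : ℂ)) := by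
  obtain ⟨B, rfl, hB⟩ := exists_transpose_mul_self hQ
  have hBT : B.transpose.det ≠ 0 := by rwa [Matrix.det_transpose]
  set K : ℝ := (2 * Real.pi) ^ (-(n : ℝ) / 2) with hK
  have hdet : (B.transpose * B).det ^ (-(1 / 2) : ℝ) = |B.det|⁻¹ := by
    rw [Matrix.det_mul, Matrix.det_transpose, ← sq, ← sq_abs, Real.rpow_neg (by positivity),
      ← Real.sqrt_eq_rpow, Real.sqrt_sq (abs_nonneg _)]
  have hpt : ∀ v : Fin n → ℝ, Complex.exp (((t ⬝ᵥ B.transpose.mulVec v : ℝ) : ℂ) * Complex.I) *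
      (gaussianDensity (B.transpose * B) (B.transpose.mulVec v) : ℂ) =
      ((K * |B.det|⁻¹ : ℝ) : ℂ) * Complex.exp (-(1 / 2 : ℂ) * ∑ i, (v i : ℂ) ^ 2 +
        ∑ i, ((B.mulVec t i : ℂ) * Complex.I) * v i) := by
    intro v
    have h1 : t ⬝ᵥ B.transpose.mulVec v = ∑ i, B.mulVec t i * v i := by
      rw [Matrix.dotProduct_mulVec, Matrix.vecMul_transpose]; rfl
    have h2 : v ⬝ᵥ v = ∑ i, v i ^ 2 := by simp [dotProduct, sq]
    rw [gaussianDensity, dotProduct_inv_mulVec_transpose hB, hdet, h1, h2, Complex.exp_add]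
    have h3 : ∑ i, ((B.mulVec t i : ℂ) * Complex.I) * v i =
        ((∑ i, B.mulVec t i * v i : ℝ) : ℂ) * Complex.I := by
      push_cast
      rw [Finset.sum_mul]
      exact Finset.sum_congr rfl fun i _ => by ring
    rw [h3]
    push_cast
    ring
  have hre : 0 < (1 / 2 : ℂ).re := by norm_num
  have hint := (GaussianFourier.integrable_cexp_neg_mul_sum_add hre
    (fun i => (B.mulVec t i : ℂ) * Complex.I)).const_mul ((K * |B.det|⁻¹ : ℝ) : ℂ)
  have hval := GaussianFourier.integral_cexp_neg_mul_sum_add hre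
    (fun i => (B.mulVec t i : ℂ) * Complex.I)
  have hemb := measurableEmbedding_mulVec hBT
  rw [volume_eq_smul_map_mulVec hBT]
  refine ⟨?_, ?_⟩
  · refine Integrable.smul_measure ?_ ENNReal.ofReal_ne_top
    rw [hemb.integrable_map_iff]
    exact hint.congr (Eventually.of_forall fun v => (hpt v).symm)
  · rw [integral_smul_measure, hemb.integral_map]
    simp_rw [hpt]
    rw [integral_const_mul, hval, ENNReal.toReal_ofReal (abs_nonneg _), Matrix.det_transpose]
    have h4 : ((Real.pi : ℂ) / (1 / 2 : ℂ)) ^ ((Fintype.card (Fin n) : ℂ) / 2) =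
        (((2 * Real.pi) ^ ((n : ℝ) / 2) : ℝ) : ℂ) := by
      rw [Complex.ofReal_cpow (by positivity)]
      push_cast
      rw [Fintype.card_fin]
      congr 1
      ring
    have h5 : (∑ i, ((B.mulVec t i : ℂ) * Complex.I) ^ 2) / (4 * (1 / 2 : ℂ)) =
        ((-(1 / 2) * (t ⬝ᵥ (B.transpose * B).mulVec t) : ℝ) : ℂ) := by
      have : t ⬝ᵥ (B.transpose * B).mulVec t = ∑ i, B.mulVec t i ^ 2 := by
        rw [← Matrix.mulVec_mulVec, Matrix.dotProduct_mulVec, Matrix.vecMul_transpose]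
        simp [dotProduct, sq]
      rw [this]
      simp_rw [mul_pow, Complex.I_sq, ← Finset.sum_mul]
      push_cast
      ring
    rw [h4, h5, Complex.real_smul, ← mul_assoc, ← mul_assoc, ← Complex.ofReal_mul,
      ← Complex.ofReal_mul]
    have h6 : |B.det| * (K * |B.det|⁻¹) * (2 * Real.pi) ^ ((n : ℝ) / 2) = 1 := by
      have hKK : K * (2 * Real.pi) ^ ((n : ℝ) / 2) = 1 := by
        rw [hK, ← Real.rpow_add (by positivity), neg_div, neg_add_cancel, Real.rpow_zero]
      have : |B.det| ≠ 0 := abs_ne_zero.2 hB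
      field_simp
      linarith
    rw [h6, Complex.ofReal_one, one_mul]

lemma gaussianDensity_nonneg {Q : Matrix (Fin n) (Fin n) ℝ} (hQ : Q.PosDef) (y : Fin n → ℝ) :
    0 ≤ gaussianDensity Q y :=
  mul_nonneg (by positivity) (mul_nonneg (Real.exp_pos _).le (Real.rpow_nonneg hQ.det_pos.le _))

lemma integrable_gaussianDensity {Q : Matrix (Fin n) (Fin n) ℝ} (hQ : Q.PosDef) :
    Integrable (gaussianDensity Q) := by
  simpa using (integrable_and_integral_gaussianDensity hQ 0).1.re

lemma integral_gaussianDensity {Q : Matrix (Fin n) (Fin n) ℝ} (hQ : Q.PosDef) :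
    ∫ y, gaussianDensity Q y = 1 := by
  have h := (integrable_and_integral_gaussianDensity hQ 0).2
  simp only [zero_dotProduct, Complex.ofReal_zero, zero_mul, Complex.exp_zero, one_mul, mul_zero,
    integral_complex_ofReal] at h
  exact_mod_cast h

/-- A lower bound on the determinant that makes the Gaussian densities uniformly bounded. -/
lemma pow_le_det_smul_one_add {M : Matrix (Fin n) (Fin n) ℝ} (hM : M.PosSemidef) {c : ℝ}
    (hc : 0 ≤ c) : c ^ n ≤ (c • (1 : Matrix (Fin n) (Fin n) ℝ) + M).det := by
  have hH : (c • (1 : Matrix (Fin n) (Fin n) ℝ) + M).IsHermitian :=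
    ((Matrix.PosSemidef.one.smul hc).add hM).1
  rw [hH.det_eq_prod_eigenvalues]
  calc c ^ n = ∏ _i : Fin n, c := by simp
    _ ≤ ∏ i, ((hH.eigenvalues i : ℝ)) := by
      refine Finset.prod_le_prod (fun _ _ => hc) fun i _ => ?_
      rw [hH.eigenvalues_eq]
      have h1 := hM.dotProduct_mulVec_nonneg (hH.eigenvectorBasis i).ofLp
      have h2 : star (hH.eigenvectorBasis i).ofLp ⬝ᵥ (hH.eigenvectorBasis i).ofLp = 1 := by
        have := hH.eigenvectorBasis.orthonormal.1 i
        rw [EuclideanSpace.norm_eq, Real.sqrt_eq_one] at this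
        simpa [dotProduct, sq] using this
      rw [Matrix.add_mulVec, Matrix.smul_mulVec, Matrix.one_mulVec, dotProduct_add,
        dotProduct_smul, h2]
      simpa using h1

lemma gaussianDensity_le {M : Matrix (Fin n) (Fin n) ℝ} (hM : M.PosSemidef) {c : ℝ}
    (hc : 0 < c) (y : Fin n → ℝ) :
    gaussianDensity (c • (1 : Matrix (Fin n) (Fin n) ℝ) + M) y ≤
      (2 * Real.pi) ^ (-(n : ℝ) / 2) * (c ^ n) ^ (-(1 / 2) : ℝ) := by
  have hQ : (c • (1 : Matrix (Fin n) (Fin n) ℝ) + M).PosDef :=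
    (Matrix.PosDef.one.smul hc).add_posSemidef hM
  refine mul_le_mul_of_nonneg_left ?_ (by positivity)
  have h1 : 0 ≤ y ⬝ᵥ Matrix.mulVec (c • (1 : Matrix (Fin n) (Fin n) ℝ) + M)⁻¹ y := by
    simpa using hQ.inv.posSemidef.dotProduct_mulVec_nonneg y
  calc _ ≤ 1 * (c • (1 : Matrix (Fin n) (Fin n) ℝ) + M).det ^ (-(1 / 2) : ℝ) :=
        mul_le_mul_of_nonneg_right (Real.exp_le_one_iff.2 (by linarith))
          (Real.rpow_nonneg hQ.det_pos.le _)
    _ ≤ _ := by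
        rw [one_mul]
        exact Real.rpow_le_rpow_of_nonpos (by positivity) (pow_le_det_smul_one_add hM hc.le)
          (by norm_num)

end Gaussian

/-! ### The Gaussian scale mixture -/

/-- The joint law of i.i.d. variables with density `p` has the product density. -/
lemma pi_densityLaw {ι : Type*} [Fintype ι] {p : ℝ → ℝ} (hp : ∀ t, 0 ≤ p t)
    (hint : Integrable p) :
    Measure.pi (fun _ : ι => densityLaw p) =
      (volume : Measure (ι → ℝ)).withDensity (fun s => ENNReal.ofReal (∏ i, p (s i))) := by
  have : IsFiniteMeasure (densityLaw p) := isFiniteMeasure_withDensity_ofReal hint.2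
  refine Measure.pi_eq fun S hS => ?_
  have hprod : Integrable (fun s : ι → ℝ => ∏ i, p (s i))
      (Measure.pi fun i => volume.restrict (S i)) :=
    Integrable.fintype_prod fun i => hint.restrict
  rw [withDensity_apply _ (MeasurableSet.univ_pi hS), volume_pi, Measure.restrict_pi_pi,
    ← ofReal_integral_eq_lintegral_ofReal hprod
      (Eventually.of_forall fun s => Finset.prod_nonneg fun i _ => hp _),
    integral_fintype_prod_eq_prod (f := fun _ => p),
    ENNReal.ofReal_prod_of_nonneg fun i _ => integral_nonneg hp]
  refine Finset.prod_congr rfl fun i _ => ?_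
  rw [densityLaw, withDensity_apply _ (hS i),
    ofReal_integral_eq_lintegral_ofReal hint.restrict (Eventually.of_forall hp)]

section Mixture

variable {n d : ℕ} {α ν σ : ℝ} {x : Fin n → Fin d → ℝ}

lemma signVec_mul_self (τ : Fin n → ℤˣ) (i : Fin n) : signVec τ i * signVec τ i = 1 := by
  rcases Int.units_eq_one_or (τ i) with h | h <;> simp [signVec, h]

lemma covQ_apply (s : PosPattern x → ℝ) (i j : Fin n) :
    covQ α ν σ x s i j = σ ^ 2 * (1 : Matrix (Fin n) (Fin n) ℝ) i j +
      ν * ∑ l, patternProb x l.1 ^ (2 / α) * s l * signVec l.1 i * signVec l.1 j := by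
  simp only [covQ, Matrix.add_apply, Matrix.smul_apply, smul_eq_mul, Matrix.sum_apply,
    Matrix.vecMulVec_apply, mul_assoc]

lemma covQ_diag (s : PosPattern x → ℝ) (i : Fin n) :
    covQ α ν σ x s i i = σ ^ 2 + ν * ∑ l, patternProb x l.1 ^ (2 / α) * s l := by
  simp_rw [covQ_apply, mul_assoc, signVec_mul_self]
  simp

lemma covQ_off_diag (s : PosPattern x → ℝ) {i j : Fin n} (hij : i ≠ j) :
    covQ α ν σ x s i j =
      ν * ∑ l, patternProb x l.1 ^ (2 / α) * s l * signVec l.1 i * signVec l.1 j := by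
  simp [covQ_apply, hij]

/-- The part of `Q(s)` that comes from the limit process, without the noise `σ² I`. -/
lemma posSemidef_limitCov (hν : 0 ≤ ν) {s : PosPattern x → ℝ} (hs : ∀ l, 0 ≤ s l) :
    (ν • ∑ l : PosPattern x, (patternProb x l.1 ^ (2 / α) * s l) •
      Matrix.vecMulVec (signVec l.1) (signVec l.1)).PosSemidef := by
  refine Matrix.PosSemidef.smul (Matrix.posSemidef_sum _ fun l _ => ?_) hν
  refine Matrix.PosSemidef.smul ?_ (mul_nonneg (Real.rpow_nonneg l.2.le _) (hs l))
  simpa using Matrix.posSemidef_vecMulVec_self_star (signVec l.1)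

lemma posDef_covQ (hν : 0 ≤ ν) (hσ : 0 < σ) {s : PosPattern x → ℝ} (hs : ∀ l, 0 ≤ s l) :
    (covQ α ν σ x s).PosDef :=
  (Matrix.PosDef.one.smul (pow_pos hσ 2)).add_posSemidef (posSemidef_limitCov hν hs)

lemma dotProduct_covQ_mulVec (s : PosPattern x → ℝ) (t : Fin n → ℝ) :
    t ⬝ᵥ (covQ α ν σ x s).mulVec t = σ ^ 2 * (t ⬝ᵥ t) +
      ∑ l, ν * patternProb x l.1 ^ (2 / α) * (t ⬝ᵥ signVec l.1) ^ 2 * s l := by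
  rw [covQ, Matrix.add_mulVec, Matrix.smul_mulVec, Matrix.one_mulVec, dotProduct_add,
    dotProduct_smul, Matrix.smul_mulVec, dotProduct_smul, Matrix.sum_mulVec, dotProduct_sum,
    smul_eq_mul, smul_eq_mul, Finset.mul_sum]
  congr 1
  refine Finset.sum_congr rfl fun l _ => ?_
  rw [Matrix.smul_mulVec, dotProduct_smul, Matrix.vecMulVec_mulVec, dotProduct_smul, smul_eq_mul,
    dotProduct_comm (signVec l.1) t]
  simp
  ring

lemma mixtureIntegrand_eq (p : ℝ → ℝ) (y : Fin n → ℝ) (s : PosPattern x → ℝ) :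
    (2 * Real.pi) ^ (-(n : ℝ) / 2) * mixtureIntegrand α ν σ x p y s =
      (∏ l, p (s l)) * gaussianDensity (covQ α ν σ x s) y := by
  rw [mixtureIntegrand, gaussianDensity]
  ring

lemma continuous_covQ : Continuous (covQ α ν σ x) := by
  unfold covQ
  fun_prop

lemma measurable_gaussianDensity_covQ :
    Measurable (fun z : (Fin n → ℝ) × (PosPattern x → ℝ) =>
      gaussianDensity (covQ α ν σ x z.2) z.1) := by
  have hQ : Continuous fun z : (Fin n → ℝ) × (PosPattern x → ℝ) => covQ α ν σ x z.2 :=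
    continuous_covQ.comp continuous_snd
  have hdet : Measurable fun z : (Fin n → ℝ) × (PosPattern x → ℝ) => (covQ α ν σ x z.2).det :=
    hQ.matrix_det.measurable
  have hadj : Measurable fun z : (Fin n → ℝ) × (PosPattern x → ℝ) =>
      z.1 ⬝ᵥ (covQ α ν σ x z.2).adjugate.mulVec z.1 :=
    (continuous_fst.dotProduct (hQ.matrix_adjugate.matrix_mulVec continuous_fst)).measurable
  simp only [gaussianDensity, Matrix.inv_def, Ring.inverse_eq_inv', Matrix.smul_mulVec,
    dotProduct_smul, smul_eq_mul]
  fun_prop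

/-- The law of the i.i.d. mixing variables `s_ℓ`, one for each sign pattern of positive
probability. -/
noncomputable abbrev mixingLaw (x : Fin n → Fin d → ℝ) (p : ℝ → ℝ) :
    Measure (PosPattern x → ℝ) :=
  Measure.pi fun _ => densityLaw p

variable {a : ℝ} {p : ℝ → ℝ}

lemma IsPositiveStableDensity.isProbabilityMeasure_mixingLaw (hp : IsPositiveStableDensity a p) :
    IsProbabilityMeasure (mixingLaw x p) := by
  have := hp.isProbabilityMeasure
  infer_instance

lemma IsPositiveStableDensity.ae_mixingLaw_pos (hp : IsPositiveStableDensity a p) :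
    ∀ᵐ s ∂mixingLaw x p, ∀ l, 0 < s l := by
  have := hp.isProbabilityMeasure
  refine ae_all_iff.2 fun l => ?_
  exact (Measure.quasiMeasurePreserving_eval (fun _ => densityLaw p) l).ae hp.ae_pos

lemma integrable_gaussianDensity_covQ (hp : IsPositiveStableDensity a p) (hν : 0 ≤ ν)
    (hσ : 0 < σ) (y : Fin n → ℝ) :
    Integrable (fun s => gaussianDensity (covQ α ν σ x s) y) (mixingLaw x p) := by
  have := hp.isProbabilityMeasure_mixingLaw (x := x)
  refine Integrable.of_bound
    ((measurable_gaussianDensity_covQ.comp measurable_prodMk_left).aestronglyMeasurable)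
    ((2 * Real.pi) ^ (-(n : ℝ) / 2) * ((σ ^ 2) ^ n) ^ (-(1 / 2) : ℝ)) ?_
  filter_upwards [hp.ae_mixingLaw_pos] with s hs
  rw [Real.norm_of_nonneg (gaussianDensity_nonneg (posDef_covQ hν hσ fun l => (hs l).le) y)]
  exact gaussianDensity_le (posSemidef_limitCov hν fun l => (hs l).le) (pow_pos hσ 2) y

lemma prod_eq_zero_of_notMem (hp : IsPositiveStableDensity a p) {s : PosPattern x → ℝ}
    (hs : s ∉ Set.univ.pi fun _ : PosPattern x => Set.Ioi (0 : ℝ)) : ∏ l, p (s l) = 0 := by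
  simp only [Set.mem_pi, Set.mem_univ, true_implies, not_forall, Set.mem_Ioi, not_lt] at hs
  obtain ⟨l, hl⟩ := hs
  exact Finset.prod_eq_zero (Finset.mem_univ l) (hp.eq_zero_of_nonpos _ hl)

lemma measurable_ofReal_prod (hp : IsPositiveStableDensity a p) :
    Measurable fun s : PosPattern x → ℝ => ENNReal.ofReal (∏ l, p (s l)) := by
  have := hp.measurable
  fun_prop

lemma toReal_ofReal_prod (hp : IsPositiveStableDensity a p) (s : PosPattern x → ℝ) :
    (ENNReal.ofReal (∏ l, p (s l))).toReal = ∏ l, p (s l) :=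
  ENNReal.toReal_ofReal (Finset.prod_nonneg fun _ _ => hp.nonneg _)

lemma integrableOn_mixtureIntegrand (hp : IsPositiveStableDensity a p) (hν : 0 ≤ ν)
    (hσ : 0 < σ) (y : Fin n → ℝ) :
    IntegrableOn (mixtureIntegrand α ν σ x p y)
      (Set.univ.pi (fun _ : PosPattern x => Set.Ioi (0 : ℝ))) := by
  have h := integrable_gaussianDensity_covQ (α := α) (x := x) hp hν hσ y
  rw [mixingLaw, pi_densityLaw hp.nonneg hp.integrable,
    integrable_withDensity_iff_integrable_smul' (measurable_ofReal_prod hp)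
      (Eventually.of_forall fun _ => ENNReal.ofReal_lt_top)] at h
  simp_rw [toReal_ofReal_prod hp, smul_eq_mul, ← mixtureIntegrand_eq] at h
  refine Integrable.integrableOn ?_
  rwa [integrable_const_mul_iff (isUnit_iff_ne_zero.2 (by positivity))] at h

lemma mixtureDensity_eq (hp : IsPositiveStableDensity a p) (y : Fin n → ℝ) :
    mixtureDensity α ν σ x p y = ∫ s, gaussianDensity (covQ α ν σ x s) y ∂mixingLaw x p := by
  rw [mixingLaw, pi_densityLaw hp.nonneg hp.integrable,
    integral_withDensity_eq_integral_toReal_smul (measurable_ofReal_prod hp)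
      (Eventually.of_forall fun _ => ENNReal.ofReal_lt_top)]
  simp_rw [toReal_ofReal_prod hp, smul_eq_mul, ← mixtureIntegrand_eq]
  rw [integral_const_mul, mixtureDensity, setIntegral_eq_integral_of_forall_compl_eq_zero]
  intro s hs
  rw [mixtureIntegrand, prod_eq_zero_of_notMem hp hs, mul_zero]

lemma integrable_prod_gaussianDensity_covQ (hp : IsPositiveStableDensity a p) (hν : 0 ≤ ν)
    (hσ : 0 < σ) :
    Integrable (fun z : (Fin n → ℝ) × (PosPattern x → ℝ) =>
      gaussianDensity (covQ α ν σ x z.2) z.1) (volume.prod (mixingLaw x p)) := by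
  have := hp.isProbabilityMeasure_mixingLaw (x := x)
  rw [integrable_prod_iff' measurable_gaussianDensity_covQ.aestronglyMeasurable]
  refine ⟨?_, (integrable_const (1 : ℝ)).congr ?_⟩
  · filter_upwards [hp.ae_mixingLaw_pos] with s hs
    exact integrable_gaussianDensity (posDef_covQ hν hσ fun l => (hs l).le)
  · filter_upwards [hp.ae_mixingLaw_pos] with s hs
    have hQ : (covQ α ν σ x s).PosDef := posDef_covQ hν hσ fun l => (hs l).le
    simp_rw [Real.norm_of_nonneg (gaussianDensity_nonneg hQ _)]
    exact (integral_gaussianDensity hQ).symm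

lemma mixtureDensity_nonneg (hp : IsPositiveStableDensity a p) (hν : 0 ≤ ν)
    (hσ : 0 < σ) (y : Fin n → ℝ) : 0 ≤ mixtureDensity α ν σ x p y := by
  rw [mixtureDensity_eq hp]
  refine integral_nonneg_of_ae ?_
  filter_upwards [hp.ae_mixingLaw_pos] with s hs
  exact gaussianDensity_nonneg (posDef_covQ hν hσ fun l => (hs l).le) y

lemma measurable_mixtureDensity (hp : IsPositiveStableDensity a p) :
    Measurable (mixtureDensity α ν σ x p) := by
  have := hp.isProbabilityMeasure_mixingLaw (x := x)
  rw [show mixtureDensity α ν σ x p = fun y => _ from funext fun y => mixtureDensity_eq hp y]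
  exact (measurable_gaussianDensity_covQ.stronglyMeasurable.integral_prod_right).measurable

lemma integrable_mixtureDensity (hp : IsPositiveStableDensity a p) (hν : 0 ≤ ν) (hσ : 0 < σ) :
    Integrable (mixtureDensity α ν σ x p) := by
  have := hp.isProbabilityMeasure_mixingLaw (x := x)
  rw [show mixtureDensity α ν σ x p = fun y => _ from funext fun y => mixtureDensity_eq hp y]
  exact (integrable_prod_gaussianDensity_covQ hp hν hσ).integral_prod_left

/-- Conditionally on `s` the mixture is Gaussian with covariance `Q(s)`, whose quadratic form is
affine in `s`; integrating over the independent coordinates of `s` gives a product of Laplace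
transforms. -/
lemma integral_exp_mul_mixtureDensity (hp : IsPositiveStableDensity a p) (ha : 0 < a)
    (ha1 : a < 1) (hν : 0 ≤ ν) (hσ : 0 < σ) (t : Fin n → ℝ) :
    ∫ y, Complex.exp (((t ⬝ᵥ y : ℝ) : ℂ) * Complex.I) * (mixtureDensity α ν σ x p y : ℂ) =
      ((Real.exp (-(1 / 2) * σ ^ 2 * (t ⬝ᵥ t)) * ∏ l : PosPattern x, Real.exp
        (-(1 / 2 * (ν * patternProb x l.1 ^ (2 / α) * (t ⬝ᵥ signVec l.1) ^ 2)) ^ a) : ℝ) : ℂ) := by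
  have := hp.isProbabilityMeasure
  have := hp.isProbabilityMeasure_mixingLaw (x := x)
  have hint : Integrable (Function.uncurry fun (y : Fin n → ℝ) (s : PosPattern x → ℝ) =>
      Complex.exp (((t ⬝ᵥ y : ℝ) : ℂ) * Complex.I) *
        (gaussianDensity (covQ α ν σ x s) y : ℂ)) (volume.prod (mixingLaw x p)) := by
    refine Integrable.bdd_mul (c := 1)
      (integrable_prod_gaussianDensity_covQ (α := α) hp hν hσ).ofReal ?_ ?_
    · have : Continuous fun z : (Fin n → ℝ) × (PosPattern x → ℝ) =>
          Complex.exp (((t ⬝ᵥ z.1 : ℝ) : ℂ) * Complex.I) := by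
        have : Continuous fun z : (Fin n → ℝ) × (PosPattern x → ℝ) => t ⬝ᵥ z.1 :=
          continuous_const.dotProduct continuous_fst
        fun_prop
      exact this.aestronglyMeasurable
    · exact Eventually.of_forall fun z => (Complex.norm_exp_ofReal_mul_I _).le
  have h1 : ∀ y, Complex.exp (((t ⬝ᵥ y : ℝ) : ℂ) * Complex.I) *
      (mixtureDensity α ν σ x p y : ℂ) = ∫ s, Complex.exp (((t ⬝ᵥ y : ℝ) : ℂ) * Complex.I) *
        (gaussianDensity (covQ α ν σ x s) y : ℂ) ∂mixingLaw x p := by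
    intro y
    rw [mixtureDensity_eq hp, integral_const_mul, integral_complex_ofReal]
  simp_rw [h1]
  rw [integral_integral_swap hint]
  set r : PosPattern x → ℝ := fun l =>
    1 / 2 * (ν * patternProb x l.1 ^ (2 / α) * (t ⬝ᵥ signVec l.1) ^ 2) with hr
  have h2 : ∀ᵐ s ∂mixingLaw x p, ∫ y, Complex.exp (((t ⬝ᵥ y : ℝ) : ℂ) * Complex.I) *
      (gaussianDensity (covQ α ν σ x s) y : ℂ) =
      ((Real.exp (-(1 / 2) * σ ^ 2 * (t ⬝ᵥ t)) * ∏ l, Real.exp (-r l * s l) : ℝ) : ℂ) := by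
    filter_upwards [hp.ae_mixingLaw_pos] with s hs
    rw [(integrable_and_integral_gaussianDensity (posDef_covQ hν hσ fun l => (hs l).le) t).2,
      dotProduct_covQ_mulVec, ← Complex.ofReal_exp, ← Real.exp_sum, ← Real.exp_add]
    congr 2
    rw [mul_add, Finset.mul_sum]
    congr 1
    · ring
    · exact Finset.sum_congr rfl fun l _ => by rw [hr]; ring
  rw [integral_congr_ae h2, integral_complex_ofReal, integral_const_mul,
    integral_fintype_prod_eq_prod (f := fun l u => Real.exp (-r l * u))]
  congr 2
  refine Finset.prod_congr rfl fun l _ => hp.integral_exp_neg_mul ha ha1 ?_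
  have := Real.rpow_nonneg l.2.le (2 / α)
  positivity

end Mixture

/-! ### The infinite-width limit -/

section Network

variable {n d : ℕ}

lemma measurable_sign : Measurable Real.sign := by
  unfold Real.sign
  exact Measurable.ite measurableSet_Iio measurable_const
    (Measurable.ite measurableSet_Ioi measurable_const measurable_const)

lemma measurable_hiddenUnit (z : Fin d → ℝ) :
    Measurable fun u : ℝ × (Fin d → ℝ) => hiddenUnit u z := by
  unfold hiddenUnit
  exact measurable_sign.comp (by fun_prop)

/-- The preactivation of a hidden unit almost surely does not vanish, because of its
independent Gaussian bias. -/
lemma ae_preactivation_ne_zero (z : Fin d → ℝ) :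
    ∀ᵐ u ∂innerLaw d, u.1 + ∑ i, u.2 i * z i ≠ 0 := by
  have hm : MeasurableSet {u : ℝ × (Fin d → ℝ) | u.1 + ∑ i, u.2 i * z i ≠ 0} :=
    (measurableSet_singleton (0 : ℝ)).compl.preimage
      (f := fun u : ℝ × (Fin d → ℝ) => u.1 + ∑ i, u.2 i * z i) (by fun_prop)
  unfold innerLaw
  rw [Measure.ae_prod_iff_ae_ae hm, Measure.ae_ae_comm hm]
  have := nullSingletonClass_gaussianReal (μ := 0) (v := 1) one_ne_zero
  refine Eventually.of_forall fun w => ?_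
  filter_upwards [measure_eq_zero_iff_ae_notMem.1
    (measure_singleton (μ := gaussianReal 0 1) (-∑ i, w i * z i))] with b hb h
  exact hb (eq_neg_of_add_eq_zero_left h)

lemma ae_exists_signVec (x : Fin n → Fin d → ℝ) :
    ∀ᵐ u ∂innerLaw d, ∃ τ : Fin n → ℤˣ, ∀ j, hiddenUnit u (x j) = signVec τ j := by
  filter_upwards [ae_all_iff.2 fun j => ae_preactivation_ne_zero (x j)] with u hu
  have h : ∀ j, ∃ e : ℤˣ, hiddenUnit u (x j) = ((e : ℤ) : ℝ) := fun j => by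
    rcases Real.sign_apply_eq_of_ne_zero _ (hu j) with h | h
    · exact ⟨-1, by simp [hiddenUnit, h]⟩
    · exact ⟨1, by simp [hiddenUnit, h]⟩
  choose τ hτ using h
  exact ⟨τ, hτ⟩

lemma signVec_injective : Function.Injective (signVec (n := n)) := by
  intro τ τ' h
  funext j
  have := congrFun h j
  simp only [signVec, Int.cast_inj] at this
  exact Units.ext this

lemma measurableSet_pattern (x : Fin n → Fin d → ℝ) (τ : Fin n → ℤˣ) :
    MeasurableSet {u : ℝ × (Fin d → ℝ) | ∀ j, hiddenUnit u (x j) = signVec τ j} := by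
  simp only [Set.ofPred_forall]
  exact MeasurableSet.iInter fun j =>
    measurableSet_eq_fun (measurable_hiddenUnit (x j)) measurable_const

/-- The law of the sign vector of a hidden unit is `∑_ℓ q_ℓ δ_{τ_ℓ}`. -/
lemma integral_comp_hiddenUnit (x : Fin n → Fin d → ℝ) (g : (Fin n → ℝ) → ℂ) :
    ∫ u, g (fun j => hiddenUnit u (x j)) ∂innerLaw d =
      ∑ l : PosPattern x, (patternProb x l.1 : ℂ) * g (signVec l.1) := by
  classical
  have h1 : ∀ᵐ u ∂innerLaw d, g (fun j => hiddenUnit u (x j)) =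
      ∑ τ : Fin n → ℤˣ, Set.indicator {u | ∀ j, hiddenUnit u (x j) = signVec τ j}
        (fun _ => g (signVec τ)) u := by
    filter_upwards [ae_exists_signVec x] with u ⟨τ, hτ⟩
    have hτ' : (fun j => hiddenUnit u (x j)) = signVec τ := funext hτ
    rw [Finset.sum_eq_single τ]
    · rw [Set.indicator_of_mem (by exact hτ), hτ']
    · intro τ' _ hne
      refine Set.indicator_of_notMem (fun h => hne ?_) _
      exact signVec_injective ((funext h : (fun j => hiddenUnit u (x j)) = _).symm.trans hτ')
    · simp
  have h2 : ∀ τ : Fin n → ℤˣ, ∫ u, Set.indicator {u | ∀ j, hiddenUnit u (x j) = signVec τ j}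
      (fun _ => g (signVec τ)) u ∂innerLaw d = (patternProb x τ : ℂ) * g (signVec τ) := by
    intro τ
    rw [integral_indicator (measurableSet_pattern x τ), setIntegral_const, Complex.real_smul,
      patternProb]
  rw [integral_congr_ae h1, integral_finsetSum _ fun τ _ =>
    (integrable_const _).indicator (measurableSet_pattern x τ)]
  simp_rw [h2]
  rw [← Finset.sum_subtype (Finset.univ.filter fun τ => 0 < patternProb x τ) (by simp)
    fun τ => (patternProb x τ : ℂ) * g (signVec τ)]
  refine (Finset.sum_filter_of_ne fun τ _ h => ?_).symm
  refine lt_of_le_of_ne measureReal_nonneg fun h0 => h ?_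
  rw [← h0, Complex.ofReal_zero, zero_mul]

lemma sum_patternProb (x : Fin n → Fin d → ℝ) :
    ∑ l : PosPattern x, (patternProb x l.1 : ℂ) = 1 := by
  simpa using (integral_comp_hiddenUnit x fun _ => 1).symm

lemma stableCharFun_symm {α c t : ℝ} :
    stableCharFun α 0 c t = Complex.exp (-((c ^ α * |t| ^ α : ℝ) : ℂ)) := by
  simp [stableCharFun]

lemma scale_rpow {α ν : ℝ} (hα : α ≠ 0) (hν : 0 ≤ ν) (m : ℕ) :
    ((ν / 2) ^ (1 / 2 : ℝ) * (m : ℝ) ^ (-1 / α)) ^ α = (ν / 2) ^ (α / 2) / m := by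
  rw [Real.mul_rpow (by positivity) (by positivity), ← Real.rpow_mul (by positivity),
    ← Real.rpow_mul (by positivity), div_mul_cancel₀ _ hα, Real.rpow_neg_one, div_eq_mul_inv]
  congr 2
  ring

/-- The characteristic function of the outputs of a network of width `m`. -/
lemma integral_exp_networkOutput {α c : ℝ} {W : ProbabilityMeasure ℝ}
    (hW : IsStableLaw α 0 c (W : Measure ℝ)) (m : ℕ) (x : Fin n → Fin d → ℝ) (t : Fin n → ℝ) :
    ∫ θ, Complex.exp (((t ⬝ᵥ fun i => networkOutput θ (x i) : ℝ) : ℂ) * Complex.I)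
        ∂networkPrior d m W =
      (∑ l : PosPattern x, (patternProb x l.1 : ℂ) *
        Complex.exp (-((c ^ α * |t ⬝ᵥ signVec l.1| ^ α : ℝ) : ℂ))) ^ m := by
  have h1 : ∀ θ : Fin m → ℝ × (ℝ × (Fin d → ℝ)),
      Complex.exp (((t ⬝ᵥ fun i => networkOutput θ (x i) : ℝ) : ℂ) * Complex.I) =
      ∏ j, Complex.exp ((((θ j).1 * (t ⬝ᵥ fun i => hiddenUnit (θ j).2 (x i)) : ℝ) : ℂ) *
        Complex.I) := by
    intro θ
    rw [← Complex.exp_sum, ← Finset.sum_mul, ← Complex.ofReal_sum]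
    congr 3
    simp only [networkOutput, dotProduct, Finset.mul_sum]
    rw [Finset.sum_comm]
    exact Finset.sum_congr rfl fun j _ => Finset.sum_congr rfl fun i _ => by ring
  simp_rw [h1]
  rw [networkPrior, integral_fintype_prod_eq_pow (ι := Fin m) (f := fun w : ℝ × (ℝ × (Fin d → ℝ)) =>
    Complex.exp (((w.1 * (t ⬝ᵥ fun i => hiddenUnit w.2 (x i)) : ℝ) : ℂ) * Complex.I)),
    Fintype.card_fin]
  congr 1
  have hmeas : Measurable fun w : ℝ × (ℝ × (Fin d → ℝ)) =>
      w.1 * (t ⬝ᵥ fun i => hiddenUnit w.2 (x i)) := by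
    simp only [dotProduct]
    have := fun i => measurable_hiddenUnit (x i)
    fun_prop
  have hint : Integrable (fun w : ℝ × (ℝ × (Fin d → ℝ)) =>
      Complex.exp (((w.1 * (t ⬝ᵥ fun i => hiddenUnit w.2 (x i)) : ℝ) : ℂ) * Complex.I))
      ((W : Measure ℝ).prod (innerLaw d)) :=
    Integrable.of_bound (Measurable.aestronglyMeasurable (by fun_prop)) 1
      (Eventually.of_forall fun w => (Complex.norm_exp_ofReal_mul_I _).le)
  rw [integral_prod_symm _ hint]
  have h2 : ∀ v : Fin n → ℝ, ∫ w : ℝ, Complex.exp (((w * (t ⬝ᵥ v) : ℝ) : ℂ) * Complex.I)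
      ∂(W : Measure ℝ) = Complex.exp (-((c ^ α * |t ⬝ᵥ v| ^ α : ℝ) : ℂ)) := by
    intro v
    rw [← stableCharFun_symm, ← hW.2, charFun_apply_real]
    refine integral_congr_ae (Eventually.of_forall fun w => ?_)
    simp only
    push_cast
    ring_nf
  simp_rw [h2]
  exact integral_comp_hiddenUnit x fun v => Complex.exp (-((c ^ α * |t ⬝ᵥ v| ^ α : ℝ) : ℂ))

/-- The compound Poisson limit `(∑_ℓ q_ℓ exp (-b_ℓ / m)) ^ m → exp (-∑_ℓ q_ℓ b_ℓ)`. -/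
lemma tendsto_sum_mul_exp_neg_div_pow {ι : Type*} [Fintype ι] {q : ι → ℂ} (hq : ∑ l, q l = 1)
    (b : ι → ℝ) :
    Tendsto (fun m : ℕ => (∑ l, q l * Complex.exp (-((b l / m : ℝ) : ℂ))) ^ m) atTop
      (nhds (Complex.exp (-∑ l, q l * b l))) := by
  have h0 : ∀ c : ℂ, Tendsto (fun m : ℕ => (m : ℂ) * (Complex.exp (c / m) - 1)) atTop
      (nhds c) := by
    intro c
    -- `m (exp (c / m) - 1)` is a difference quotient of `z ↦ exp (c z)` at `0`.
    have hd : HasDerivAt (fun z : ℝ => Complex.exp (c * z)) c 0 := by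
      have h := ((Complex.ofRealCLM.hasDerivAt (x := 0)).const_mul c).cexp
      simpa using h
    have h := hd.tendsto_slope_zero_right.comp
      (tendsto_inv_atTop_nhdsGT_zero.comp (tendsto_natCast_atTop_atTop (R := ℝ)))
    refine h.congr fun m => ?_
    simp [div_eq_mul_inv]
  have h1 : Tendsto (fun m : ℕ => (m : ℂ) *
      ∑ l, q l * (Complex.exp (-((b l / m : ℝ) : ℂ)) - 1)) atTop
      (nhds (-∑ l, q l * b l)) := by
    rw [← Finset.sum_neg_distrib]
    simp_rw [Finset.mul_sum]
    refine tendsto_finsetSum _ fun l _ => ?_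
    have := (h0 (-(b l : ℂ))).const_mul (q l)
    rw [mul_neg] at this
    refine this.congr fun m => ?_
    push_cast
    rw [neg_div]
    ring
  refine (Complex.tendsto_one_add_pow_exp_of_tendsto h1).congr fun m => ?_
  congr 1
  simp_rw [mul_sub, mul_one, Finset.sum_sub_distrib, hq]
  ring

variable {Ω : Type*} [MeasurableSpace Ω] {P : Measure Ω} [IsProbabilityMeasure P] {α ν : ℝ}
  {f : (Fin d → ℝ) → Ω → ℝ}

lemma IsInfiniteWidthLimit.aemeasurable (hf : IsInfiniteWidthLimit P α ν f)
    (x : Fin n → Fin d → ℝ) : AEMeasurable (fun ω i => f (x i) ω) P := by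
  obtain ⟨W, -, h⟩ := hf
  exact (h n x).aemeasurable_limit

lemma continuous_exp_dotProduct_mul_I (t : Fin n → ℝ) :
    Continuous fun y : Fin n → ℝ => Complex.exp (((t ⬝ᵥ y : ℝ) : ℂ) * Complex.I) := by
  have : Continuous fun y : Fin n → ℝ => t ⬝ᵥ y := continuous_const.dotProduct continuous_id
  fun_prop

/-- The characteristic function of the limit process at finitely many inputs. -/
lemma IsInfiniteWidthLimit.integral_exp (hf : IsInfiniteWidthLimit P α ν f) (hα : 0 < α)
    (hν : 0 ≤ ν) (x : Fin n → Fin d → ℝ) (t : Fin n → ℝ) :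
    ∫ y, Complex.exp (((t ⬝ᵥ y : ℝ) : ℂ) * Complex.I) ∂P.map (fun ω i => f (x i) ω) =
      Complex.exp (-∑ l : PosPattern x, (patternProb x l.1 : ℂ) *
        (((ν / 2) ^ (α / 2) * |t ⬝ᵥ signVec l.1| ^ α : ℝ) : ℂ)) := by
  obtain ⟨W, hW, h⟩ := hf
  have hconv := (ProbabilityMeasure.tendsto_iff_forall_integral_rclike_tendsto ℂ).1
    (h n x).tendsto (BoundedContinuousFunction.ofNormedAddCommGroup _
      (continuous_exp_dotProduct_mul_I t) 1 fun y => (Complex.norm_exp_ofReal_mul_I _).le)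
  simp only [BoundedContinuousFunction.coe_ofNormedAddCommGroup, ProbabilityMeasure.coe_mk]
    at hconv
  refine tendsto_nhds_unique hconv ?_
  refine (tendsto_sum_mul_exp_neg_div_pow (sum_patternProb x)
    (fun l => (ν / 2) ^ (α / 2) * |t ⬝ᵥ signVec l.1| ^ α)).congr' ?_
  filter_upwards [eventually_gt_atTop 0] with m hm
  rw [integral_map ((h n x).forall_aemeasurable m)
    (continuous_exp_dotProduct_mul_I t).aestronglyMeasurable,
    integral_exp_networkOutput (hW m hm), scale_rpow hα.ne' hν]
  congr 1
  refine Finset.sum_congr rfl fun l _ => ?_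
  rw [mul_div_right_comm]

end Network

/-! ### The law of the observations -/

section Observations

variable {n : ℕ}

lemma exists_forall_eq_dotProduct (L : StrongDual ℝ (Fin n → ℝ)) :
    ∃ t : Fin n → ℝ, ∀ y, L y = t ⬝ᵥ y := by
  refine ⟨fun i => L (Pi.single i 1), fun y => ?_⟩
  conv_lhs => rw [← Finset.univ_sum_single y, map_sum]
  refine Finset.sum_congr rfl fun i _ => ?_
  rw [show (Pi.single i (y i) : Fin n → ℝ) = y i • Pi.single i 1 by simp [← Pi.single_smul],
    map_smul, smul_eq_mul, mul_comm]

lemma integral_exp_pi_gaussianReal (v : NNReal) (t : Fin n → ℝ) :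
    ∫ y, Complex.exp (((t ⬝ᵥ y : ℝ) : ℂ) * Complex.I) ∂Measure.pi (fun _ => gaussianReal 0 v) =
      ((Real.exp (-(1 / 2) * v * (t ⬝ᵥ t)) : ℝ) : ℂ) := by
  have h : ∀ y : Fin n → ℝ, Complex.exp (((t ⬝ᵥ y : ℝ) : ℂ) * Complex.I) =
      ∏ i, Complex.exp ((t i : ℂ) * y i * Complex.I) := by
    intro y
    rw [← Complex.exp_sum, ← Finset.sum_mul]
    simp [dotProduct]
  simp_rw [h]
  rw [integral_fintype_prod_eq_prod (f := fun i (y : ℝ) => Complex.exp ((t i : ℂ) * y * Complex.I))]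
  simp_rw [← charFun_apply_real, charFun_gaussianReal]
  rw [← Complex.exp_sum, Complex.ofReal_exp]
  congr 1
  simp only [dotProduct]
  push_cast
  rw [Finset.mul_sum]
  exact Finset.sum_congr rfl fun i _ => by ring

/-- Matches one factor of the mixture with one term of the network limit: the exponents `2 / α` of
`q` and `2` of `c` are undone by the stable index `α / 2`. -/
lemma half_mul_rpow_eq {α ν q c : ℝ} (hα : 0 < α) (hν : 0 ≤ ν) (hq : 0 ≤ q) :
    (1 / 2 * (ν * q ^ (2 / α) * c ^ 2)) ^ (α / 2) = q * ((ν / 2) ^ (α / 2) * |c| ^ α) := by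
  rw [show 1 / 2 * (ν * q ^ (2 / α) * c ^ 2) = q ^ (2 / α) * ((ν / 2) * |c| ^ 2) by
    rw [sq_abs]; ring, Real.mul_rpow (by positivity) (by positivity),
    Real.mul_rpow (by positivity) (by positivity), ← Real.rpow_mul hq,
    ← Real.rpow_natCast_mul (abs_nonneg _)]
  congr 2
  · rw [div_mul_div_cancel₀ hα.ne', div_self two_ne_zero, Real.rpow_one]
  · congr 1
    push_cast
    ring

end Observations

end StableNet

theorem theorem1 {Ω : Type*} [MeasurableSpace Ω] (P : Measure Ω) [IsProbabilityMeasure P]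
    (n d : ℕ) (α ν σ : ℝ) (hα : 0 < α) (hα2 : α < 2) (hν : 0 < ν) (hσ : 0 < σ)
    -- the infinite-width limit process
    (f : (Fin d → ℝ) → Ω → ℝ) (hf : StableNet.IsInfiniteWidthLimit P α ν f)
    -- the inputs, and the i.i.d. Gaussian errors, independent of the process
    (x : Fin n → Fin d → ℝ) (ε : Fin n → Ω → ℝ)
    (hε : ∀ i, HasLaw (ε i) (gaussianReal 0 (Real.toNNReal (σ ^ 2))) P)
    (hε_indep : iIndepFun ε P)
    (hfε : IndepFun (fun ω i => f (x i) ω) (fun ω i => ε i ω) P)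
    -- the density of the positive `α/2`-stable law
    (p : ℝ → ℝ) (hp : StableNet.IsPositiveStableDensity (α / 2) p) :
    -- the integral over `(0, ∞)^L` converges, and is the joint density of the observations
    (∀ y : Fin n → ℝ, IntegrableOn (StableNet.mixtureIntegrand α ν σ x p y)
      (Set.univ.pi (fun _ : StableNet.PosPattern x => Set.Ioi (0 : ℝ)))) ∧
    HasLaw (fun ω i => f (x i) ω + ε i ω)
      ((volume : Measure (Fin n → ℝ)).withDensity
        (fun y => ENNReal.ofReal (StableNet.mixtureDensity α ν σ x p y))) P ∧
    -- `Q` is positive definite with probability one, for i.i.d. `s_ℓ` with density `p`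
    (∀ᵐ s ∂(Measure.pi fun _ : StableNet.PosPattern x => StableNet.densityLaw p),
      (StableNet.covQ α ν σ x s).PosDef) ∧
    -- the entries of `Q`
    (∀ (s : StableNet.PosPattern x → ℝ) (i : Fin n), StableNet.covQ α ν σ x s i i =
      σ ^ 2 + ν * ∑ l, StableNet.patternProb x l.1 ^ (2 / α) * s l) ∧
    (∀ (s : StableNet.PosPattern x → ℝ) (i j : Fin n), i ≠ j → StableNet.covQ α ν σ x s i j =
      ν * ∑ l, StableNet.patternProb x l.1 ^ (2 / α) * s l *
        StableNet.signVec l.1 i * StableNet.signVec l.1 j) := by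
  have ha : 0 < α / 2 := by linarith
  have ha1 : α / 2 < 1 := by linarith
  refine ⟨StableNet.integrableOn_mixtureIntegrand hp hν.le hσ, ?_,
    hp.ae_mixingLaw_pos.mono fun s hs => StableNet.posDef_covQ hν.le hσ fun l => (hs l).le,
    StableNet.covQ_diag, fun s i j => StableNet.covQ_off_diag s⟩
  have hfm := hf.aemeasurable x
  have hεm : AEMeasurable (fun ω i => ε i ω) P := aemeasurable_pi_lambda _ fun i =>
    (hε i).aemeasurable
  have hdm : Measurable fun y => ENNReal.ofReal (StableNet.mixtureDensity α ν σ x p y) :=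
    (StableNet.measurable_mixtureDensity hp).ennreal_ofReal
  refine ⟨hfm.add hεm, ?_⟩
  have hfin : IsFiniteMeasure ((volume : Measure (Fin n → ℝ)).withDensity
      (fun y => ENNReal.ofReal (StableNet.mixtureDensity α ν σ x p y))) :=
    isFiniteMeasure_withDensity_ofReal
      (StableNet.integrable_mixtureDensity hp hν.le hσ).2
  have hP : P.map (fun ω i => f (x i) ω + ε i ω) =
      (P.map fun ω i => f (x i) ω) ∗ (P.map fun ω i => ε i ω) :=
    hfε.map_add_eq_map_conv_map₀ hfm hεm
  have hεlaw : P.map (fun ω i => ε i ω) =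
      Measure.pi fun _ => gaussianReal 0 (Real.toNNReal (σ ^ 2)) := by
    rw [(iIndepFun_iff_map_fun_eq_pi_map fun i => (hε i).aemeasurable).1 hε_indep]
    simp_rw [(hε _).map_eq]
  have := Measure.isProbabilityMeasure_map hfm
  have := Measure.isProbabilityMeasure_map hεm
  -- Both sides are finite measures: compare their characteristic functions.
  rw [hP]
  refine Measure.ext_of_charFunDual (funext fun L => ?_)
  obtain ⟨t, ht⟩ := StableNet.exists_forall_eq_dotProduct L
  rw [charFunDual_conv, hεlaw]
  simp only [charFunDual_apply, ht]
  rw [hf.integral_exp hα hν.le, StableNet.integral_exp_pi_gaussianReal,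
    integral_withDensity_eq_integral_toReal_smul hdm
      (Eventually.of_forall fun _ => ENNReal.ofReal_lt_top)]
  simp_rw [ENNReal.toReal_ofReal (StableNet.mixtureDensity_nonneg hp hν.le hσ _),
    Complex.real_smul, mul_comm (Complex.ofReal (StableNet.mixtureDensity α ν σ x p _))]
  rw [StableNet.integral_exp_mul_mixtureDensity hp ha ha1 hν.le hσ,
    Real.coe_toNNReal _ (sq_nonneg σ), ← Real.exp_sum, Complex.ofReal_mul, mul_comm]
  congr 1
  rw [Complex.ofReal_exp, Finset.sum_neg_distrib]
  congr 1
  push_cast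
  congr 1
  refine Finset.sum_congr rfl fun l _ => ?_
  rw [StableNet.half_mul_rpow_eq hα hν.le l.2.le]
  push_cast
  ring
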